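/- Let $k$ be a field, $m\ge 1$, $r_1,\dots,r_m\ge 2$ integers, and let $F(X_1,\dots,X_m,Z,T)=f(Z,T)+h(X_1,\dots,X_m,Z,T)$ with $0\ne f\in k[Z,T]$ and $h\in (X_1,\dots,X_m)\,k[X_1,\dots,X_m,Z,T]$. Put $$A=\frac{k[X_1,\dots,X_m,Y,Z,T]}{(X_1^{r_1}\cdots X_m^{r_m}Y-F(X_1,\dots,X_m,Z,T))},$$ let $x_1,\dots,x_m,y,z,t$ be the images in $A$ of $X_1,\dots,X_m,Y,Z,T$, and set $E=k[x_1,\dots,x_m]$, $B=k[x_1,\dots,x_m,z,t]$ and $I=(x_1^{r_1}\cdots x_m^{r_m},\,F(x_1,\dots,x_m,z,t))B$. An exponential map on a $k$-algebra $C$ is a $k$-algebra homomorphism $\phi=\phi_U:C\to C[U]$ such that $\phi$ followed by evaluation at $U=0$ is $\mathrm{id}_C$, and $\phi_V\phi_U=\phi_{U+V}:C\to C[U,V]$, where $\phi_V$ is extended to $C[U]$ by $\phi_V(U)=U$. Let $C^\phi=\{c\in C:\phi(c)=c\}$, and let the Derksen invariant $\mathrm{DK}(C)$ be the $k$-subalgebra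 of $C$ generated by all $C^\phi$, where $\phi$ runs over the exponential maps on $C$ with $C^\phi\ne C$. Suppose that $\mathrm{DK}(A)=B$. If $\phi$ is a $k$-algebra automorphism of $A$, then: (a) $\phi$ restricts to an automorphism of $E$ and to an automorphism of $B$; (b) for each $i\in\{1,\dots,m\}$ there are $j\in\{1,\dots,m\}$ and $\lambda\in k^{*}$ with $\phi(x_i)=\lambda x_j$ and $r_i=r_j$; (c) $\phi(I)=I$. Conversely, if a $k$-algebra endomorphism $\phi$ of $A$ satisfies (a) and (c), then (b) holds and $\phi$ is an automorphism of $A$. -/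

import Mathlib

namespace ExpMaps

variable {k : Type*} [CommRing k] {B : Type*} [CommRing B] [Algebra k B]

/-- A `k`-algebra homomorphism `φ : B → B[U]` is an exponential map if evaluation at `U = 0`
after `φ` is the identity and `φ_V φ_U = φ_{U+V}` as maps `B → B[U, V]`.
Here `B[U, V]` is modelled by `B[V][U]`: the inner variable is `V`, the outer one is `U`,
and the extension of `φ_V` to `B[U]` fixing `U` acts on coefficients. -/
structure IsExponentialMap (φ : B →ₐ[k] Polynomial B) : Prop where
  eval_zero : ∀ b : B, (φ b).eval 0 = b
  comp : ∀ b : B,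
    (φ b).map (φ : B →+* Polynomial B) =
      (φ b).eval₂ ((Polynomial.C : Polynomial B →+* Polynomial (Polynomial B)).comp Polynomial.C)
        (Polynomial.X + Polynomial.C Polynomial.X)

/-- The ring of invariants `B^φ = {b ∈ B | φ(b) = b}`. -/
noncomputable def invariants (φ : B →ₐ[k] Polynomial B) : Subalgebra k B :=
  AlgHom.equalizer φ Polynomial.CAlgHom

variable (k B) in
/-- The Derksen invariant: the `k`-subalgebra generated by the invariants of all non-trivial
exponential maps of the `k`-algebra `B`. -/
noncomputable def derksenInvariant : Subalgebra k B :=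
  Algebra.adjoin k {b : B | ∃ φ : B →ₐ[k] Polynomial B,
    IsExponentialMap φ ∧ invariants φ ≠ ⊤ ∧ b ∈ invariants φ}

/-- The endomorphism `φ` restricts to a `k`-algebra automorphism of the subalgebra `S`. -/
def RestrictsToAut (φ : B →ₐ[k] B) (S : Subalgebra k B) : Prop :=
  ∃ e : S ≃ₐ[k] S, ∀ s : S, (e s : B) = φ (s : B)

end ExpMaps

namespace LinearHypersurface

variable {k : Type*} [Field k] {m : ℕ}

/-- The polynomial ring `k[X_1, …, X_m, Z, T]`: the variables are `X_i = X (Sum.inl i)`,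
`Z = X (Sum.inr 0)` and `T = X (Sum.inr 1)`. -/
abbrev PolyXZT (k : Type*) [Field k] (m : ℕ) : Type _ := MvPolynomial (Fin m ⊕ Fin 2) k

/-- The inclusion `k[Z, T] → k[X_1, …, X_m, Z, T]`, where `k[Z, T]` is `MvPolynomial (Fin 2) k`. -/
noncomputable def ofZT (m : ℕ) (f : MvPolynomial (Fin 2) k) : PolyXZT k m :=
  MvPolynomial.rename Sum.inr f

/-- The monomial `X_1^{r_1} ⋯ X_m^{r_m}`. -/
noncomputable def monoX (k : Type*) [Field k] (r : Fin m → ℕ) : PolyXZT k m :=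
  ∏ i, (MvPolynomial.X (Sum.inl i)) ^ r i

/-- The ring `A = k[X_1, …, X_m, Y, Z, T] / (X_1^{r_1} ⋯ X_m^{r_m} Y - F)`, where
`k[X_1, …, X_m, Y, Z, T]` is the polynomial ring `k[X_1, …, X_m, Z, T][Y]`. -/
def A (r : Fin m → ℕ) (F : PolyXZT k m) : Type _ :=
  Polynomial (PolyXZT k m) ⧸
    Ideal.span {Polynomial.C (monoX k r) * Polynomial.X - Polynomial.C F}

noncomputable instance (r : Fin m → ℕ) (F : PolyXZT k m) : CommRing (A r F) :=
  inferInstanceAs (CommRing (Polynomial (PolyXZT k m) ⧸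
    Ideal.span {Polynomial.C (monoX k r) * Polynomial.X - Polynomial.C F}))

noncomputable instance (r : Fin m → ℕ) (F : PolyXZT k m) : Algebra k (A r F) :=
  inferInstanceAs (Algebra k (Polynomial (PolyXZT k m) ⧸
    Ideal.span {Polynomial.C (monoX k r) * Polynomial.X - Polynomial.C F}))

variable (r : Fin m → ℕ) (F : PolyXZT k m)

/-- The quotient map `k[X_1, …, X_m, Z, T][Y] → A`. -/
noncomputable def quotientMap : Polynomial (PolyXZT k m) →ₐ[k] A r F :=
  Ideal.Quotient.mkₐ k
    (Ideal.span {Polynomial.C (monoX k r) * Polynomial.X - Polynomial.C F})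

/-- The canonical map `k[X_1, …, X_m, Z, T] → A`, `P ↦ P(x_1, …, x_m, z, t)`. -/
noncomputable def toA : PolyXZT k m →ₐ[k] A r F :=
  (quotientMap r F).comp Polynomial.CAlgHom

/-- The image `x_i` of `X_i` in `A`. -/
noncomputable def x (i : Fin m) : A r F := toA r F (MvPolynomial.X (Sum.inl i))

/-- The image `z` of `Z` in `A`. -/
noncomputable def z : A r F := toA r F (MvPolynomial.X (Sum.inr 0))

/-- The image `t` of `T` in `A`. -/
noncomputable def t : A r F := toA r F (MvPolynomial.X (Sum.inr 1))

/-- The subalgebra `E = k[x_1, …, x_m]` of `A`. -/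
noncomputable def E : Subalgebra k (A r F) := Algebra.adjoin k (Set.range (x r F))

/-- The subalgebra `B = k[x_1, …, x_m, z, t]` of `A`. -/
noncomputable def B : Subalgebra k (A r F) :=
  Algebra.adjoin k (Set.range (x r F) ∪ {z r F, t r F})

theorem toA_mem_B (P : PolyXZT k m) : toA r F P ∈ B r F := by
  induction P using MvPolynomial.induction_on with
  | C a =>
    have h : toA r F (MvPolynomial.C a) = algebraMap k (A r F) a := (toA r F).commutes a
    rw [h]
    exact Subalgebra.algebraMap_mem _ a
  | add p q hp hq =>
    rw [map_add]
    exact add_mem hp hq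
  | mul_X p v hp =>
    rw [map_mul]
    refine mul_mem hp (Algebra.subset_adjoin ?_)
    rcases v with i | j
    · exact Or.inl ⟨i, rfl⟩
    · fin_cases j
      · exact Or.inr (Or.inl rfl)
      · exact Or.inr (Or.inr rfl)

/-- The ideal `I = (x_1^{r_1} ⋯ x_m^{r_m}, F(x_1, …, x_m, z, t)) B` of the ring `B`. -/
noncomputable def I : Ideal (B r F) :=
  Ideal.span {⟨toA r F (monoX k r), toA_mem_B r F _⟩, ⟨toA r F F, toA_mem_B r F _⟩}

/-- The ideal `I` of `B`, viewed as a subset of `A`. -/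
def ISet : Set (A r F) := Subtype.val '' (I r F : Set (B r F))

/-- Condition (a): `φ` restricts to an automorphism of `E` and to an automorphism of `B`. -/
def CondA (φ : A r F →ₐ[k] A r F) : Prop :=
  ExpMaps.RestrictsToAut φ (E r F) ∧ ExpMaps.RestrictsToAut φ (B r F)

/-- Condition (b): `φ` sends each `x_i` to a non-zero scalar multiple of some `x_j` with
`r_i = r_j`. -/
def CondB (φ : A r F →ₐ[k] A r F) : Prop :=
  ∀ i : Fin m, ∃ j : Fin m, ∃ c : k, c ≠ 0 ∧ φ (x r F i) = c • x r F j ∧ r i = r j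

/-- Condition (c): `φ(I) = I`. -/
def CondC (φ : A r F →ₐ[k] A r F) : Prop :=
  φ '' ISet r F = ISet r F

end LinearHypersurface

namespace LinearHypersurface

open MvPolynomial

/-! ### Divisibility and ideals in `k[X_1, …, X_m, Z, T]`. -/

section PolynomialRing

variable {k : Type*} [Field k] {m : ℕ}

/-! Write `R = k[X_1, …, X_m, Z, T]` and `a = X_1^{r_1} ⋯ X_m^{r_m}`. Then `R ≅ B ⊆ A ⊆ R[1/a]` with
`y = F/a`, and everything is computed in the factorial ring `R`.

Conjugation permutes the non-trivial exponential maps, so an automorphism `φ` of `A` preserves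
`DK(A) = B` and induces an automorphism `ψ` of `R`. Clearing denominators in `φ(y) = ψ(F)/ψ(a)`,
where `ψ(a)` and `ψ(F)` are coprime, shows that `ψ(a)` divides a power of `a`; hence `ψ` permutes
the `X_i` up to scalars (`exists_perm_of_algEquiv`).

The exponents are read off from the identity `dA ∩ B = (d, F)` for `d ∣ a` (`mem_span_of_toA_dvd`,
`toA_dvd_of_mem_span`). If `ψ(X_i) ~ X_j` with `r_i > r_j`, then `ψ(F)` is too divisible by `x_j` in
`A`, which forces `F ∈ (X_i, F)^2` (`le_of_algEquiv`). This is impossible because `F(X_i = 0) ∉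
k[X_1, …, X_m]`, the second use of `DK(A) = B` (`setZero_notMem_range_ofX`). So `r_i ≤ r_{σ(i)}` for
a permutation `σ`, hence equality; `a` is fixed up to a unit, and so is `I = aA ∩ B`.

For the converse, the same condition on `F(X_j = 0)` gives `I ∩ E = aE` (`monoX_dvd_of_mem_span`),
so (a) and (c) force `ψ(a) ~ a`. This yields (b), and `φ(I) = I` puts `y = F/a` in the image of `φ`.
-/

theorem prime_X_inl (j : Fin m) : Prime (X (Sum.inl j) : PolyXZT k m) := X_prime

theorem monoX_ne_zero (r : Fin m → ℕ) : monoX k r ≠ 0 :=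
  Finset.prod_ne_zero_iff.mpr fun _ _ => pow_ne_zero _ (X_ne_zero _)

theorem X_inl_pow_dvd_monoX (r : Fin m → ℕ) (j : Fin m) :
    (X (Sum.inl j) : PolyXZT k m) ^ r j ∣ monoX k r :=
  Finset.dvd_prod_of_mem (fun i => (X (Sum.inl i) : PolyXZT k m) ^ r i) (Finset.mem_univ j)

theorem dvd_X_inl_of_prime_dvd_monoX {r : Fin m → ℕ} {p : PolyXZT k m} (hp : Prime p)
    (h : p ∣ monoX k r) : ∃ j, p ∣ X (Sum.inl j) := by
  obtain ⟨j, -, hj⟩ := hp.exists_mem_finset_dvd h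
  exact ⟨j, hp.dvd_of_dvd_pow hj⟩

/-- Setting `X_j = 0` in `k[X_1, …, X_m, Z, T]`. -/
noncomputable def setZero (j : Fin m) : PolyXZT k m →ₐ[k] PolyXZT k m :=
  aeval (Function.update X (Sum.inl j) 0)

theorem setZero_X_self (j : Fin m) : setZero j (X (Sum.inl j) : PolyXZT k m) = 0 := by
  simp [setZero]

theorem X_inl_dvd_sub_setZero (j : Fin m) (p : PolyXZT k m) :
    X (Sum.inl j) ∣ p - setZero j p := by
  rw [← Ideal.mem_span_singleton, ← Ideal.Quotient.eq]
  have : (Ideal.Quotient.mkₐ k (Ideal.span {(X (Sum.inl j) : PolyXZT k m)})) =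
      (Ideal.Quotient.mkₐ k _).comp (setZero j) := by
    refine algHom_ext fun v => ?_
    by_cases hv : v = Sum.inl j
    · subst hv
      simp [setZero_X_self]
    · simp [setZero, Function.update_of_ne hv]
  exact DFunLike.congr_fun this p

theorem setZero_eq_zero_iff {j : Fin m} {p : PolyXZT k m} :
    setZero j p = 0 ↔ X (Sum.inl j) ∣ p := by
  constructor
  · intro h
    simpa [h] using X_inl_dvd_sub_setZero j p
  · rintro ⟨q, rfl⟩
    rw [map_mul, setZero_X_self, zero_mul]

/-- The cofactor of `X_j^{r_j}` does not involve `X_j`, so it survives `X_j = 0` unchanged. -/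
theorem exists_monoX_eq (r : Fin m → ℕ) (j : Fin m) :
    ∃ c : PolyXZT k m, monoX k r = X (Sum.inl j) ^ r j * c ∧ ¬ X (Sum.inl j) ∣ c ∧
      setZero j c = c := by
  refine ⟨∏ i ∈ Finset.univ.erase j, X (Sum.inl i) ^ r i,
    (Finset.mul_prod_erase _ _ (Finset.mem_univ j)).symm, fun hd => ?_, ?_⟩
  · obtain ⟨i, hi, hd⟩ := (prime_X_inl j).exists_mem_finset_dvd hd
    have := X_dvd_X.mp ((prime_X_inl j).dvd_of_dvd_pow hd)
    exact (Finset.ne_of_mem_erase hi) (Sum.inl_injective this).symm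
  · rw [map_prod]
    refine Finset.prod_congr rfl fun i hi => ?_
    have h : (Sum.inl i : Fin m ⊕ Fin 2) ≠ Sum.inl j :=
      fun e => Finset.ne_of_mem_erase hi (Sum.inl_injective e)
    simp [setZero, Function.update_of_ne h]

/-- Setting `X_1 = ⋯ = X_m = 0` in `k[X_1, …, X_m, Z, T]`. -/
noncomputable def killX : PolyXZT k m →ₐ[k] PolyXZT k m :=
  aeval (Sum.elim 0 fun i => X (Sum.inr i))

theorem killX_X_inl (j : Fin m) : killX (X (Sum.inl j) : PolyXZT k m) = 0 := by
  simp [killX]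

theorem killX_ofZT (f : MvPolynomial (Fin 2) k) : killX (ofZT m f) = ofZT m f := by
  simp only [killX, ofZT, aeval_rename]
  rw [← aeval_X_left_apply (rename Sum.inr f), aeval_rename]
  rfl

theorem not_X_inl_dvd_of_killX_ne_zero {p : PolyXZT k m} (h : killX p ≠ 0) (j : Fin m) :
    ¬ X (Sum.inl j) ∣ p := by
  rintro ⟨q, rfl⟩
  exact h (by rw [map_mul, killX_X_inl, zero_mul])

theorem killX_setZero (j : Fin m) (p : PolyXZT k m) : killX (setZero j p) = killX p := by
  obtain ⟨q, hq⟩ := X_inl_dvd_sub_setZero j p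
  have := congrArg killX hq
  rw [map_sub, map_mul, killX_X_inl, zero_mul, sub_eq_zero] at this
  exact this.symm

theorem le_of_X_inl_pow_dvd_monoX {r : Fin m → ℕ} {j : Fin m} {n : ℕ}
    (h : (X (Sum.inl j) : PolyXZT k m) ^ n ∣ monoX k r) : n ≤ r j := by
  obtain ⟨c, hc, hndvd, -⟩ := exists_monoX_eq (k := k) r j
  by_contra! hlt
  refine hndvd ?_
  have h1 := (pow_dvd_pow (X (Sum.inl j) : PolyXZT k m) (Nat.succ_le_of_lt hlt)).trans h
  rw [hc, pow_succ] at h1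
  exact (mul_dvd_mul_iff_left (pow_ne_zero _ (X_ne_zero _))).mp h1

theorem isRelPrime_monoX (r : Fin m → ℕ) {F : PolyXZT k m}
    (hF : ∀ j : Fin m, ¬ X (Sum.inl j) ∣ F) : IsRelPrime (monoX k r) F := by
  rw [UniqueFactorizationMonoid.isRelPrime_iff_no_prime_factors (monoX_ne_zero r)]
  intro d hd hdF hdp
  obtain ⟨j, hj⟩ := dvd_X_inl_of_prime_dvd_monoX hdp hd
  have := (hdp.irreducible.associated_of_dvd (prime_X_inl j).irreducible hj).symm.dvd
  exact hF j (this.trans hdF)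

theorem monoX_dvd {r : Fin m → ℕ} {p : PolyXZT k m}
    (h : ∀ j, X (Sum.inl j) ^ r j ∣ p) : monoX k r ∣ p := by
  refine Fintype.prod_dvd_of_isRelPrime (fun i j hij => ?_) h
  refine IsRelPrime.pow ?_
  rw [(prime_X_inl i).irreducible.isRelPrime_iff_not_dvd]
  exact fun hd => hij (Sum.inl_injective (X_dvd_X.mp hd))

/-- The inclusion `k[X_1, …, X_m] → k[X_1, …, X_m, Z, T]`. -/
noncomputable def ofX : MvPolynomial (Fin m) k →ₐ[k] PolyXZT k m := rename Sum.inl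

theorem degreeOf_ofX (i : Fin 2) (p : MvPolynomial (Fin m) k) :
    degreeOf (Sum.inr i) (ofX p) = 0 := by
  classical
  by_contra h
  have h1 : Sum.inr i ∈ (ofX p).vars := by
    rw [mem_vars_iff_degreeOf_ne_zero]; exact h
  obtain ⟨j, -, hj⟩ := mem_vars_rename _ _ h1
  exact absurd hj (by simp)

theorem mem_range_ofX_of_degreeOf {p : PolyXZT k m}
    (h : ∀ i : Fin 2, degreeOf (Sum.inr i) p = 0) : p ∈ (ofX (k := k) (m := m)).range := by
  obtain ⟨q, hq⟩ := exists_rename_eq_of_vars_subset_range p (Sum.inl : Fin m → Fin m ⊕ Fin 2)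
    Sum.inl_injective (by
      rintro (j | i) hv
      · exact ⟨j, rfl⟩
      · exact absurd (h i) (mem_vars_iff_degreeOf_ne_zero.mp hv))
  exact ⟨q, hq⟩

/-- Degrees in `Z` and `T` add under multiplication, so `k[X_1, …, X_m]` is factorially closed. -/
theorem mem_range_ofX_of_mul {p q : PolyXZT k m} (hne : p * q ≠ 0)
    (h : p * q ∈ (ofX (k := k) (m := m)).range) : q ∈ (ofX (k := k) (m := m)).range := by
  refine mem_range_ofX_of_degreeOf fun i => ?_
  obtain ⟨g, hg⟩ := h
  have h1 := degreeOf_ofX i g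
  change ofX g = p * q at hg
  rw [hg, degreeOf_mul_eq (left_ne_zero_of_mul hne) (right_ne_zero_of_mul hne)] at h1
  omega

theorem setZero_ofX (j : Fin m) (p : MvPolynomial (Fin m) k) :
    setZero j (ofX p) = ofX (aeval (Function.update X j 0) p) := by
  have : (setZero j).comp (ofX (k := k)) = ofX.comp (aeval (Function.update X j 0)) := by
    refine algHom_ext fun i => ?_
    by_cases h : i = j
    · subst h; simp [ofX, setZero]
    · have h' : (Sum.inl i : Fin m ⊕ Fin 2) ≠ Sum.inl j := fun e => h (Sum.inl_injective e)
      simp [ofX, setZero, Function.update_of_ne h, Function.update_of_ne h']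
  exact DFunLike.congr_fun this p

theorem monoX_mem_range_ofX (r : Fin m → ℕ) :
    monoX k r ∈ (ofX (k := k) (m := m)).range :=
  prod_mem fun i _ => pow_mem (AlgHom.mem_range _ |>.mpr ⟨X i, by simp [ofX]⟩) _

/-- If no `F(X_j = 0)` lies in `k[X_1, …, X_m]`, then the ideal `(X_1^{r_1} ⋯ X_m^{r_m}, F)`
meets `k[X_1, …, X_m]` in the multiples of `X_1^{r_1} ⋯ X_m^{r_m}`. -/
theorem monoX_dvd_of_mem_span {r : Fin m → ℕ} {F : PolyXZT k m}
    (hF : ∀ j, setZero j F ∉ (ofX (k := k) (m := m)).range) {p : PolyXZT k m}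
    (hp : p ∈ (ofX (k := k) (m := m)).range) (hI : p ∈ Ideal.span {monoX k r, F}) :
    monoX k r ∣ p := by
  by_cases hp0 : p = 0
  · simp [hp0]
  obtain ⟨u, v, huv⟩ := Ideal.mem_span_pair.mp hI
  refine monoX_dvd fun j => ?_
  have hFj : ¬ X (Sum.inl j) ∣ F := fun hd =>
    hF j (by rw [setZero_eq_zero_iff.mpr hd]; exact zero_mem _)
  -- Induction on the power of `X_j`: cancel `X_j^s` from `p = u a + v F`, possible since `X_j ∤ F`,
  -- and set `X_j = 0`. A non-zero result would make `F(X_j = 0)` a factor of an element of `k[X_1,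
  -- …, X_m]`.
  have key : ∀ s ≤ r j, (X (Sum.inl j) : PolyXZT k m) ^ s ∣ p := by
    intro s
    induction s with
    | zero => simp
    | succ s ih =>
      intro hs
      obtain ⟨q, hq⟩ := ih (by omega)
      obtain ⟨c, hc⟩ := (pow_dvd_pow (X (Sum.inl j) : PolyXZT k m) hs).trans
        (X_inl_pow_dvd_monoX r j)
      have hv : (X (Sum.inl j) : PolyXZT k m) ^ s ∣ v := by
        refine (prime_X_inl j).pow_dvd_of_dvd_mul_right s hFj ?_
        refine ⟨q - u * X (Sum.inl j) * c, ?_⟩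
        rw [hc] at huv
        linear_combination huv + hq
      obtain ⟨w, rfl⟩ := hv
      have hqw : q = X (Sum.inl j) * (u * c) + w * F := by
        refine mul_left_cancel₀ (pow_ne_zero s (X_ne_zero (Sum.inl j))) ?_
        rw [hc] at huv
        linear_combination -huv - hq
      rw [hq, pow_succ]
      refine mul_dvd_mul_left _ (setZero_eq_zero_iff.mp ?_)
      by_contra hne
      have hqE : q ∈ (ofX (k := k) (m := m)).range :=
        mem_range_ofX_of_mul (hq ▸ hp0) (hq ▸ hp)
      obtain ⟨q₀, rfl⟩ := hqE
      have h1 : setZero j (ofX q₀) = setZero j w * setZero j F := by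
        have := congrArg (setZero j) hqw
        simpa [setZero_X_self] using this
      exact hF j (mem_range_ofX_of_mul (h1 ▸ hne) (h1 ▸ ⟨_, (setZero_ofX j q₀).symm⟩))
  exact key _ le_rfl

/-- At `X_j = 0` membership reads `F_j ∈ (F_j^2)` with `F_j = F(X_j = 0) ≠ 0`, so `F_j` would be a
unit and lie in `k[X_1, …, X_m]`. -/
theorem not_mem_span_sq {F : PolyXZT k m} {j : Fin m} (hF0 : ¬ X (Sum.inl j) ∣ F)
    (hF : setZero j F ∉ (ofX (k := k) (m := m)).range) :
    F ∉ Ideal.span {X (Sum.inl j), F} ^ 2 := by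
  intro h
  have h1 : setZero j F ∈ Ideal.span {setZero j F ^ 2} := by
    have := Ideal.mem_map_of_mem (setZero j) h
    rw [Ideal.map_pow, Ideal.map_span, Set.image_pair, setZero_X_self,
      Ideal.span_insert_zero, Ideal.span_singleton_pow] at this
    exact this
  obtain ⟨q, hq⟩ := Ideal.mem_span_singleton.mp h1
  have hne : setZero j F ≠ 0 := fun h0 => hF0 (setZero_eq_zero_iff.mp h0)
  have h2 : q * setZero j F = 1 := mul_left_cancel₀ hne (by linear_combination -hq)
  exact hF (mem_range_ofX_of_mul (by rw [h2]; exact one_ne_zero) (h2 ▸ one_mem _))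

/-- The cofactor of `X_j^{r_j}` in `X_1^{r_1} ⋯ X_m^{r_m}` is a non-zero-divisor modulo
`(X_j, F)`. -/
theorem mem_span_of_mul_mem_span {r : Fin m → ℕ} {F : PolyXZT k m} (hF : killX F ≠ 0)
    {j : Fin m} {c v : PolyXZT k m} (hcm : c ∣ monoX k r)
    (hcj : setZero j c = c) (h : v * c ∈ Ideal.span {X (Sum.inl j), F}) :
    v ∈ Ideal.span {X (Sum.inl j), F} := by
  obtain ⟨s, t, hst⟩ := Ideal.mem_span_pair.mp h
  have h1 : setZero j t * setZero j F = setZero j v * c := by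
    have := congrArg (setZero j) hst
    simpa [setZero_X_self, hcj] using this
  -- A prime factor of `c` is some `X_i` up to a unit, and no `X_i` divides `F(X_j = 0)`, which is
  -- still non-zero once all the `X_i` vanish.
  have hrel : IsRelPrime c (setZero j F) := by
    rw [UniqueFactorizationMonoid.isRelPrime_iff_no_prime_factors
      (ne_zero_of_dvd_ne_zero (monoX_ne_zero r) hcm)]
    intro d hd hdF hdp
    obtain ⟨i, hi⟩ := dvd_X_inl_of_prime_dvd_monoX hdp (hd.trans hcm)
    have hXd := (hdp.irreducible.associated_of_dvd (prime_X_inl i).irreducible hi).symm.dvd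
    exact not_X_inl_dvd_of_killX_ne_zero ((killX_setZero j F).symm ▸ hF) i (hXd.trans hdF)
  obtain ⟨t', ht'⟩ := hrel.dvd_of_dvd_mul_right (Dvd.intro_left _ h1.symm)
  have hc0 : c ≠ 0 := ne_zero_of_dvd_ne_zero (monoX_ne_zero r) hcm
  have h2 : setZero j v = t' * setZero j F :=
    mul_left_cancel₀ hc0 (by rw [ht'] at h1; linear_combination -h1)
  obtain ⟨p, hp⟩ := X_inl_dvd_sub_setZero j v
  obtain ⟨q, hq⟩ := X_inl_dvd_sub_setZero j F
  exact Ideal.mem_span_pair.mpr ⟨p - t' * q, t', by linear_combination -hp - h2 + t' * hq⟩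

theorem exists_eq_C_mul_of_associated_X {p : PolyXZT k m} {v : Fin m ⊕ Fin 2}
    (h : Associated p (X v)) : ∃ c : k, c ≠ 0 ∧ p = C c * X v := by
  obtain ⟨u, hu⟩ := h.symm
  obtain ⟨c, hc, huc⟩ := isUnit_iff_eq_C_of_isReduced.mp u.isUnit
  exact ⟨c, hc.ne_zero, by rw [← hu, huc, mul_comm]⟩

/-- If each `ψ(X_i)` divides a power of `X_1^{r_1} ⋯ X_m^{r_m}`, then `ψ` permutes the `X_i` up
to scalars. -/
theorem exists_perm_of_dvd {r : Fin m → ℕ} (ψ : PolyXZT k m ≃ₐ[k] PolyXZT k m)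
    (h : ∀ i, ∃ n, ψ (X (Sum.inl i)) ∣ monoX k r ^ n) :
    ∃ (σ : Equiv.Perm (Fin m)) (c : Fin m → k), ∀ i, c i ≠ 0 ∧
      ψ (X (Sum.inl i)) = C (c i) * X (Sum.inl (σ i)) := by
  have h1 : ∀ i, ∃ j, Associated (ψ (X (Sum.inl i))) (X (Sum.inl j)) := by
    intro i
    obtain ⟨n, hn⟩ := h i
    have hp : Prime (ψ (X (Sum.inl i))) := (MulEquiv.prime_iff ψ).mpr (prime_X_inl i)
    obtain ⟨j, hj⟩ := dvd_X_inl_of_prime_dvd_monoX hp (hp.dvd_of_dvd_pow hn)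
    exact ⟨j, hp.irreducible.associated_of_dvd (prime_X_inl j).irreducible hj⟩
  choose σ hσ using h1
  have hinj : Function.Injective σ := by
    intro i j hij
    have h2 : ψ (X (Sum.inl i)) ∣ ψ (X (Sum.inl j)) :=
      ((hσ i).trans (by rw [hij]; exact (hσ j).symm)).dvd
    exact Sum.inl_injective (X_dvd_X.mp ((map_dvd_iff ψ).mp h2))
  choose c hc using fun i => exists_eq_C_mul_of_associated_X (hσ i)
  exact ⟨Equiv.ofBijective σ (Finite.injective_iff_bijective.mp hinj), c, hc⟩

end PolynomialRing

/-- Both sides have the same sum over `ι`. -/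
theorem eq_of_le_comp_perm {ι : Type*} [Fintype ι] {r : ι → ℕ} {σ : Equiv.Perm ι}
    (h : ∀ i, r i ≤ r (σ i)) (i : ι) : r i = r (σ i) :=
  (Finset.sum_eq_sum_iff_of_le fun i _ => h i).mp (Equiv.sum_comp σ r).symm i (Finset.mem_univ i)

end LinearHypersurface

namespace LinearHypersurface

open MvPolynomial

/-! ### The ring `A` between `B` and its localization at `x_1^{r_1} ⋯ x_m^{r_m}`. -/

section StructureOfA

variable {k : Type*} [Field k] {m : ℕ} (r : Fin m → ℕ) (F : PolyXZT k m)

/-- The image `y` of `Y` in `A`. -/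
noncomputable def y : A r F := quotientMap r F Polynomial.X

theorem quotientMap_surjective : Function.Surjective (quotientMap r F) :=
  Ideal.Quotient.mk_surjective

theorem quotientMap_eq_zero_iff {P : Polynomial (PolyXZT k m)} :
    quotientMap r F P = 0 ↔ Polynomial.C (monoX k r) * Polynomial.X - Polynomial.C F ∣ P :=
  Ideal.Quotient.eq_zero_iff_mem.trans Ideal.mem_span_singleton

theorem quotientMap_C (p : PolyXZT k m) : quotientMap r F (Polynomial.C p) = toA r F p := rfl

theorem toA_monoX_mul_y : toA r F (monoX k r) * y r F = toA r F F := by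
  rw [← quotientMap_C, ← quotientMap_C, y, ← map_mul, ← sub_eq_zero, ← map_sub,
    quotientMap_eq_zero_iff]

theorem toA_injective : Function.Injective (toA r F) := by
  refine (injective_iff_map_eq_zero _).mpr fun p hp => ?_
  rw [← quotientMap_C, quotientMap_eq_zero_iff] at hp
  by_contra hne
  have h1 : (Polynomial.C (monoX k r) * Polynomial.X - Polynomial.C F).natDegree = 1 := by
    rw [Polynomial.natDegree_sub_C, Polynomial.natDegree_C_mul_X _ (monoX_ne_zero r)]
  have h2 := Polynomial.natDegree_le_of_dvd hp (Polynomial.C_ne_zero.mpr hne)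
  rw [h1, Polynomial.natDegree_C] at h2
  omega

variable {F} in
-- `aY - F` is linear in `Y` with coprime coefficients, hence irreducible, hence prime in the
-- factorial ring `R[Y]`.
theorem isDomain_A (hF : ∀ j : Fin m, ¬ X (Sum.inl j) ∣ F) : IsDomain (A r F) := by
  have h1 : Irreducible (Polynomial.C (monoX k r) * Polynomial.X + Polynomial.C (-F)) :=
    Polynomial.irreducible_C_mul_X_add_C (monoX_ne_zero r) (isRelPrime_monoX r hF).neg_right
  have h2 := h1.prime
  rw [Polynomial.C_neg, ← sub_eq_add_neg] at h2
  have h3 := (Ideal.span_singleton_prime h2.ne_zero).mpr h2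
  exact Ideal.Quotient.isDomain _

theorem exists_monoX_pow_mul_eq (α : A r F) :
    ∃ (n : ℕ) (p : PolyXZT k m), toA r F (monoX k r) ^ n * α = toA r F p := by
  obtain ⟨P, rfl⟩ := quotientMap_surjective r F α
  induction P using Polynomial.induction_on' with
  | add P Q hP hQ =>
    obtain ⟨n, p, hp⟩ := hP
    obtain ⟨l, q, hq⟩ := hQ
    refine ⟨n + l, monoX k r ^ l * p + monoX k r ^ n * q, ?_⟩
    simp only [map_add, map_mul, map_pow, ← hp, ← hq]
    ring
  | monomial n p =>
    refine ⟨n, F ^ n * p, ?_⟩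
    rw [← Polynomial.C_mul_X_pow_eq_monomial, map_mul, map_pow, quotientMap_C, map_mul, map_pow,
      ← toA_monoX_mul_y, y]
    ring

variable {r F} in
/-- A ring homomorphism from `A` to a domain which does not kill `x_1^{r_1} ⋯ x_m^{r_m}` is
determined by its restriction to `B`. -/
theorem ringHom_ext_of_toA {D : Type*} [CommRing D] [IsDomain D] {g₁ g₂ : A r F →+* D}
    (h : ∀ v, g₁ (toA r F (X v)) = g₂ (toA r F (X v)))
    (hC : ∀ c : k, g₁ (algebraMap k _ c) = g₂ (algebraMap k _ c))
    (h0 : g₁ (toA r F (monoX k r)) ≠ 0) : g₁ = g₂ := by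
  have h' : g₁.comp (toA r F : PolyXZT k m →+* A r F) = g₂.comp (toA r F) := by
    refine MvPolynomial.ringHom_ext (fun c => ?_) h
    have : toA r F (C c) = algebraMap k _ c := (toA r F).commutes c
    simpa [this] using hC c
  have h'' (p : PolyXZT k m) : g₁ (toA r F p) = g₂ (toA r F p) := DFunLike.congr_fun h' p
  ext α
  obtain ⟨n, p, hp⟩ := exists_monoX_pow_mul_eq r F α
  have h1 := congrArg g₁ hp
  have h2 := congrArg g₂ hp
  rw [map_mul, map_pow] at h1 h2
  rw [← h'', ← h'', ← h1] at h2
  exact (mul_left_cancel₀ (pow_ne_zero _ h0) h2).symm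

theorem B_eq_range : B r F = (toA r F).range := by
  refine le_antisymm (Algebra.adjoin_le ?_) ?_
  · rintro _ (⟨i, rfl⟩ | rfl | rfl) <;> exact ⟨_, rfl⟩
  · rintro _ ⟨p, rfl⟩
    exact toA_mem_B r F p

theorem mem_B_iff {α : A r F} : α ∈ B r F ↔ ∃ p, toA r F p = α := by
  rw [B_eq_range]; rfl

theorem E_eq_range : E r F = ((toA r F).comp ofX).range := by
  refine le_antisymm (Algebra.adjoin_le ?_) ?_
  · rintro _ ⟨i, rfl⟩
    exact ⟨X i, by simp [ofX, x]⟩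
  · rintro _ ⟨p, rfl⟩
    have : (toA r F).comp ofX = aeval (x r F) := by
      refine algHom_ext fun i => ?_
      simp [ofX, x]
    change (toA r F).comp ofX p ∈ _
    rw [this, E, Algebra.adjoin_range_eq_range_aeval]
    exact ⟨p, rfl⟩

theorem toA_mem_E_iff {p : PolyXZT k m} :
    toA r F p ∈ E r F ↔ p ∈ (ofX (k := k) (m := m)).range := by
  rw [E_eq_range]
  constructor
  · rintro ⟨q, hq⟩
    exact ⟨q, toA_injective r F hq⟩
  · rintro ⟨q, rfl⟩
    exact ⟨q, rfl⟩

theorem mem_ISet_iff {α : A r F} :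
    α ∈ ISet r F ↔ ∃ p ∈ Ideal.span {monoX k r, F}, toA r F p = α := by
  simp only [ISet, I, Set.mem_image, SetLike.mem_coe, Ideal.mem_span_pair]
  constructor
  · rintro ⟨_, ⟨⟨b, hb⟩, ⟨c, hc⟩, rfl⟩, rfl⟩
    obtain ⟨p, rfl⟩ := (mem_B_iff r F).mp hb
    obtain ⟨q, rfl⟩ := (mem_B_iff r F).mp hc
    exact ⟨_, ⟨p, q, rfl⟩, by simp⟩
  · rintro ⟨_, ⟨p, q, rfl⟩, rfl⟩
    exact ⟨_, ⟨⟨_, toA_mem_B r F p⟩, ⟨_, toA_mem_B r F q⟩, rfl⟩, by simp⟩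

variable {r F} in
/-- If `d` divides `X_1^{r_1} ⋯ X_m^{r_m}`, then the coefficients of a polynomial in `y` that is
divisible by `d` in `A` lie in the ideal `(d, F)`. -/
theorem coeff_mem_of_dvd {d : PolyXZT k m} (hd : d ∣ monoX k r) {P : Polynomial (PolyXZT k m)}
    (h : toA r F d ∣ quotientMap r F P) (n : ℕ) : P.coeff n ∈ Ideal.span {d, F} := by
  obtain ⟨c, hc⟩ := hd
  obtain ⟨α, hα⟩ := h
  obtain ⟨Q, rfl⟩ := quotientMap_surjective r F α
  rw [← quotientMap_C, ← map_mul, ← sub_eq_zero, ← map_sub, quotientMap_eq_zero_iff] at hα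
  obtain ⟨S, hS⟩ := hα
  have h1 : P = Polynomial.C d * Q + (Polynomial.C (monoX k r) * Polynomial.X -
      Polynomial.C F) * S := by rw [← hS]; ring
  have hdm : Polynomial.C d ∈ (Ideal.span {d, F}).map Polynomial.C :=
    Ideal.mem_map_of_mem _ (Ideal.subset_span (by simp))
  have hFm : Polynomial.C F ∈ (Ideal.span {d, F}).map Polynomial.C :=
    Ideal.mem_map_of_mem _ (Ideal.subset_span (by simp))
  -- Since `d ∣ a`, the relation `aY - F` itself lies in the extended ideal `(d, F)R[Y]`.
  refine Ideal.mem_map_C_iff.mp ?_ n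
  rw [h1, hc, Polynomial.C_mul, mul_assoc]
  exact add_mem (Ideal.mul_mem_right _ _ hdm)
    (Ideal.mul_mem_right _ _ (sub_mem (Ideal.mul_mem_right _ _ hdm) hFm))

variable {r F} in
theorem mem_span_of_toA_dvd {d p : PolyXZT k m} (hd : d ∣ monoX k r)
    (h : toA r F d ∣ toA r F p) : p ∈ Ideal.span {d, F} := by
  simpa using coeff_mem_of_dvd (P := Polynomial.C p) hd h 0

/-- `F = ay` becomes a multiple of `d` in `A`. With `mem_span_of_toA_dvd` this gives `dA ∩ B = (d,
F)`. -/
theorem toA_dvd_of_mem_span {d p : PolyXZT k m} (hd : d ∣ monoX k r)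
    (h : p ∈ Ideal.span {d, F}) : toA r F d ∣ toA r F p := by
  obtain ⟨u, v, rfl⟩ := Ideal.mem_span_pair.mp h
  obtain ⟨c, hc⟩ := hd
  rw [map_add, map_mul, map_mul, ← toA_monoX_mul_y, hc, map_mul]
  exact ⟨toA r F u + toA r F v * toA r F c * y r F, by ring⟩

variable {F} in
/-- An element of `B` divisible in `A` by a power of `x_j` larger than `x_j^{r_j}` lies in the
square of `(x_j, F)`. -/
theorem mem_span_sq_of_toA_dvd (hF : killX F ≠ 0) {j : Fin m}
    (hr : 1 < r j) {n : ℕ} (hn : r j < n) {p : PolyXZT k m}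
    (h : toA r F (X (Sum.inl j)) ^ n ∣ toA r F p) :
    p ∈ Ideal.span {X (Sum.inl j), F} ^ 2 := by
  have := isDomain_A r (not_X_inl_dvd_of_killX_ne_zero hF)
  set ξ : PolyXZT k m := X (Sum.inl j) with hξ
  have hξ1 : ξ ∣ monoX k r := (dvd_pow_self _ (by omega)).trans (X_inl_pow_dvd_monoX r j)
  have hξA : toA r F ξ ≠ 0 := fun h0 =>
    X_ne_zero (R := k) (Sum.inl j) ((map_eq_zero_iff _ (toA_injective r F)).mp h0)
  obtain ⟨c, hc, -, hcj⟩ := exists_monoX_eq (k := k) r j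
  have h1 : p ∈ Ideal.span {ξ ^ r j, F} := by
    refine mem_span_of_toA_dvd (X_inl_pow_dvd_monoX r j) ?_
    rw [map_pow]
    exact (pow_dvd_pow _ hn.le).trans h
  obtain ⟨u, v, rfl⟩ := Ideal.mem_span_pair.mp h1
  -- Substituting `F = ξ^{r_j} c y` turns `uξ^{r_j} + vF` into `ξ^{r_j}(u + vcy)`; as `n > r_j`, a
  -- factor `ξ` remains after cancellation.
  have h2 : toA r F ξ ∣ quotientMap r F (Polynomial.C u + Polynomial.C (v * c) * Polynomial.X) := by
    have h3 : toA r F ξ ^ r j * toA r F ξ ∣ toA r F ξ ^ r j *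
        quotientMap r F (Polynomial.C u + Polynomial.C (v * c) * Polynomial.X) := by
      rw [← pow_succ]
      refine (pow_dvd_pow _ (Nat.succ_le_of_lt hn)).trans (h.trans (dvd_of_eq ?_))
      rw [map_add, map_add, map_mul, map_mul, map_mul, quotientMap_C, quotientMap_C,
        ← toA_monoX_mul_y, hc, y, map_mul, map_mul, map_pow]
      ring
    exact (mul_dvd_mul_iff_left (pow_ne_zero _ hξA)).mp h3
  have hu : u ∈ Ideal.span {ξ, F} := by simpa using coeff_mem_of_dvd hξ1 h2 0
  have hv : v * c ∈ Ideal.span {ξ, F} := by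
    simpa [Polynomial.coeff_C] using coeff_mem_of_dvd hξ1 h2 1
  have hv' := mem_span_of_mul_mem_span hF (Dvd.intro_left _ hc.symm) hcj hv
  have hξJ : ξ ∈ Ideal.span {ξ, F} := Ideal.subset_span (by simp)
  have hFJ : F ∈ Ideal.span {ξ, F} := Ideal.subset_span (by simp)
  rw [pow_two]
  refine add_mem (Ideal.mul_mem_mul hu ?_) (Ideal.mul_mem_mul hv' hFJ)
  exact Ideal.pow_mem_of_mem _ hξJ _ (by omega)

end StructureOfA

end LinearHypersurface

/-! ### Conjugating exponential maps; invariance of the Derksen invariant. -/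

namespace ExpMaps

variable {k : Type*} [CommRing k] {B : Type*} [CommRing B] [Algebra k B]

theorem mem_invariants {θ : B →ₐ[k] Polynomial B} {b : B} :
    b ∈ invariants θ ↔ θ b = Polynomial.C b := Iff.rfl

/-- The conjugate of `θ : B → B[U]` by an automorphism of `B`. -/
noncomputable def conj (φ : B ≃ₐ[k] B) (θ : B →ₐ[k] Polynomial B) : B →ₐ[k] Polynomial B :=
  ((Polynomial.mapAlgHom (φ : B →ₐ[k] B)).comp θ).comp (φ.symm : B →ₐ[k] B)

theorem conj_apply (φ : B ≃ₐ[k] B) (θ : B →ₐ[k] Polynomial B) (b : B) :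
    conj φ θ b = (θ (φ.symm b)).map (φ : B →+* B) := rfl

theorem IsExponentialMap.conj {θ : B →ₐ[k] Polynomial B} (h : IsExponentialMap θ)
    (φ : B ≃ₐ[k] B) : IsExponentialMap (conj φ θ) where
  eval_zero b := by
    have h1 := congrArg φ (h.eval_zero (φ.symm b))
    rw [φ.apply_symm_apply] at h1
    rw [conj_apply, Polynomial.eval_map, ← Polynomial.coe_eval₂RingHom]
    refine Eq.trans ?_ h1
    rw [Polynomial.coe_eval₂RingHom, ← Polynomial.eval_map, ← map_zero (φ : B →+* B),
      Polynomial.eval_map_apply]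
    simp
  comp b := by
    have h1 := congrArg (Polynomial.map (Polynomial.mapRingHom (φ : B →+* B)))
      (h.comp (φ.symm b))
    rw [Polynomial.map_map] at h1
    rw [conj_apply, Polynomial.map_map, Polynomial.eval₂_map]
    convert h1 using 1
    · congr 1
      ext1 c
      simp [conj_apply]
    · rw [← Polynomial.coe_mapRingHom (Polynomial.mapRingHom _), Polynomial.hom_eval₂]
      congr 1
      · ext1 c
        simp
      · simp

theorem mem_invariants_conj {φ : B ≃ₐ[k] B} {θ : B →ₐ[k] Polynomial B} {b : B}
    (h : b ∈ invariants θ) : φ b ∈ invariants (conj φ θ) := by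
  rw [mem_invariants] at h ⊢
  rw [conj_apply, φ.symm_apply_apply, h, Polynomial.map_C]
  rfl

theorem invariants_conj_ne_top {φ : B ≃ₐ[k] B} {θ : B →ₐ[k] Polynomial B}
    (h : invariants θ ≠ ⊤) : invariants (conj φ θ) ≠ ⊤ := by
  refine fun htop => h (eq_top_iff.mpr fun b _ => ?_)
  have h1 : φ b ∈ invariants (conj φ θ) := htop ▸ Algebra.mem_top
  rw [mem_invariants, conj_apply, φ.symm_apply_apply] at h1
  refine Polynomial.map_injective (φ : B →+* B) φ.injective ?_
  exact h1.trans (Polynomial.map_C (φ : B →+* B)).symm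

theorem apply_mem_derksenInvariant (φ : B ≃ₐ[k] B) {b : B} (hb : b ∈ derksenInvariant k B) :
    φ b ∈ derksenInvariant k B := by
  have : derksenInvariant k B ≤ (derksenInvariant k B).comap (φ : B →ₐ[k] B) := by
    refine Algebra.adjoin_le ?_
    rintro c ⟨θ, hθ, hne, hc⟩
    exact Algebra.subset_adjoin ⟨conj φ θ, hθ.conj φ, invariants_conj_ne_top hne,
      mem_invariants_conj hc⟩
  exact this hb

theorem restrictsToAut_of_forall_mem_iff {φ : B →ₐ[k] B} {S : Subalgebra k B}
    (hinj : ∀ s ∈ S, φ s = 0 → s = 0) (h1 : ∀ s ∈ S, φ s ∈ S)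
    (h2 : ∀ s ∈ S, ∃ u ∈ S, φ u = s) : RestrictsToAut φ S := by
  refine ⟨AlgEquiv.ofBijective ((φ.comp S.val).codRestrict S fun s => h1 _ s.2)
    ⟨(injective_iff_map_eq_zero _).mpr fun s hs => Subtype.ext (hinj s s.2 ?_), fun s => ?_⟩,
    fun s => rfl⟩
  · exact congrArg Subtype.val hs
  · obtain ⟨u, hu, hus⟩ := h2 s s.2
    exact ⟨⟨u, hu⟩, Subtype.ext hus⟩

theorem RestrictsToAut.apply_mem {φ : B →ₐ[k] B} {S : Subalgebra k B} (h : RestrictsToAut φ S)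
    {s : B} (hs : s ∈ S) : φ s ∈ S := by
  obtain ⟨e, he⟩ := h
  exact he ⟨s, hs⟩ ▸ (e ⟨s, hs⟩).2

theorem RestrictsToAut.exists_apply_eq {φ : B →ₐ[k] B} {S : Subalgebra k B}
    (h : RestrictsToAut φ S) {s : B} (hs : s ∈ S) : ∃ u ∈ S, φ u = s := by
  obtain ⟨e, he⟩ := h
  exact ⟨e.symm ⟨s, hs⟩, Subtype.property _, by rw [← he, e.apply_symm_apply]⟩

end ExpMaps

namespace LinearHypersurface

open MvPolynomial

/-! ### An exponential map on `A` and what `DK(A) = B` says about `F`. -/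

section ExponentialMap

variable {k : Type*} [Field k] {m : ℕ} {r : Fin m → ℕ} {F : PolyXZT k m}

/-- Universal property of `A`, with `w` as the image of `y`. -/
theorem exists_algHom_of_mul_eq {D : Type*} [CommRing D] [Algebra k D] (g : PolyXZT k m →ₐ[k] D)
    {w : D} (hw : g (monoX k r) * w = g F) :
    ∃ θ : A r F →ₐ[k] D, ∀ p, θ (toA r F p) = g p := by
  let G : Polynomial (PolyXZT k m) →ₐ[k] D :=
    Polynomial.eval₂AlgHom g w fun _ => Commute.all _ _
  have hG : ∀ P ∈ Ideal.span {Polynomial.C (monoX k r) * Polynomial.X - Polynomial.C F},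
      G P = 0 := by
    intro P hP
    obtain ⟨Q, rfl⟩ := Ideal.mem_span_singleton.mp hP
    rw [map_mul, map_sub, map_mul]
    simp [G, hw]
  refine ⟨Ideal.Quotient.liftₐ _ G hG, fun p => ?_⟩
  change G (Polynomial.C p) = g p
  simp [G]

theorem toA_monoX_ne_zero : toA r F (monoX k r) ≠ 0 := fun h =>
  monoX_ne_zero r ((map_eq_zero_iff _ (toA_injective r F)).mp h)

variable (r F) in
/-- The homomorphism `k[X_1, …, X_m, Z, T] → A[U]` with `X_i ↦ x_i`, `T ↦ t` and
`Z ↦ z + x_1^{r_1} ⋯ x_m^{r_m} U`. -/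
noncomputable def shiftZ : PolyXZT k m →ₐ[k] Polynomial (A r F) :=
  aeval (Sum.elim (fun i => Polynomial.C (x r F i))
    ![Polynomial.C (z r F) + Polynomial.C (toA r F (monoX k r)) * Polynomial.X,
      Polynomial.C (t r F)])

theorem shiftZ_ofX (p : MvPolynomial (Fin m) k) :
    shiftZ r F (ofX p) = Polynomial.C (toA r F (ofX p)) := by
  have : (shiftZ r F).comp ofX =
      (Polynomial.CAlgHom (R := k) (A := A r F)).comp ((toA r F).comp ofX) := by
    refine algHom_ext fun i => ?_
    simp [shiftZ, ofX, x]
  exact DFunLike.congr_fun this p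

theorem shiftZ_monoX : shiftZ r F (monoX k r) = Polynomial.C (toA r F (monoX k r)) := by
  obtain ⟨p, hp⟩ := monoX_mem_range_ofX (k := k) r
  change ofX p = _ at hp
  rw [← hp, shiftZ_ofX]

/-- The shift is trivial modulo `a` on each variable. For `p = F` the quotient is the increment of
`y`. -/
theorem dvd_shiftZ_sub (p : PolyXZT k m) :
    Polynomial.C (toA r F (monoX k r)) ∣ shiftZ r F p - Polynomial.C (toA r F p) := by
  rw [← Ideal.mem_span_singleton, ← Ideal.Quotient.eq]
  have : (Ideal.Quotient.mkₐ k (Ideal.span {Polynomial.C (toA r F (monoX k r))})).comp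
      (shiftZ r F) =
      (Ideal.Quotient.mkₐ k _).comp (Polynomial.CAlgHom.comp (toA r F)) := by
    refine algHom_ext fun v => ?_
    simp only [AlgHom.comp_apply, Ideal.Quotient.mkₐ_eq_mk]
    rw [Ideal.Quotient.eq, Ideal.mem_span_singleton]
    rcases v with i | i
    · simp [shiftZ, x]
    · fin_cases i <;> simp [shiftZ, z, t]
  exact DFunLike.congr_fun this p

/-- There is a non-trivial exponential map of `A` with `z ↦ z + x_1^{r_1} ⋯ x_m^{r_m} U` which
fixes `x_1, …, x_m`. -/
theorem exists_isExponentialMap (hF : ∀ j : Fin m, ¬ X (Sum.inl j) ∣ F) :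
    ∃ θ : A r F →ₐ[k] Polynomial (A r F), ExpMaps.IsExponentialMap θ ∧
      ExpMaps.invariants θ ≠ ⊤ ∧
      ∀ p, θ (toA r F (ofX p)) = Polynomial.C (toA r F (ofX p)) := by
  have := isDomain_A r hF
  obtain ⟨w, hw⟩ := dvd_shiftZ_sub (r := r) (F := F) F
  obtain ⟨θ, hθ⟩ := exists_algHom_of_mul_eq (r := r) (F := F) (shiftZ r F)
    (w := Polynomial.C (y r F) + w) (by
      rw [shiftZ_monoX, mul_add, ← hw, ← Polynomial.C_mul, toA_monoX_mul_y]
      ring)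
  have hx (i : Fin m) : θ (toA r F (X (Sum.inl i))) = Polynomial.C (toA r F (X (Sum.inl i))) := by
    rw [hθ]; simp [shiftZ, x]
  have hz : θ (toA r F (X (Sum.inr 0))) = Polynomial.C (toA r F (X (Sum.inr 0))) +
      Polynomial.C (toA r F (monoX k r)) * Polynomial.X := by
    rw [hθ]; simp [shiftZ, z]
  have ht : θ (toA r F (X (Sum.inr 1))) = Polynomial.C (toA r F (X (Sum.inr 1))) := by
    rw [hθ]; simp [shiftZ, t]
  have ha : θ (toA r F (monoX k r)) = Polynomial.C (toA r F (monoX k r)) := by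
    rw [hθ, shiftZ_monoX]
  have hk (c : k) : θ (algebraMap k _ c) = Polynomial.C (algebraMap k _ c) := θ.commutes c
  refine ⟨θ, ⟨fun b => ?_, fun b => ?_⟩, fun htop => ?_, fun p => by rw [hθ, shiftZ_ofX]⟩
  -- Both axioms need checking only on the generators of `B`, since the target is a domain in which
  -- the image of `a` is non-zero.
  · have : (Polynomial.evalRingHom 0).comp (θ : A r F →+* Polynomial (A r F)) =
        RingHom.id _ := by
      refine ringHom_ext_of_toA ?_ (fun c => by simp [hk]) (by simpa [ha] using toA_monoX_ne_zero)
      rintro (i | i)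
      · simp [hx]
      · fin_cases i
        · simp [hz]
        · simp [ht]
    exact DFunLike.congr_fun this b
  · have : (Polynomial.mapRingHom (θ : A r F →+* Polynomial (A r F))).comp
          (θ : A r F →+* Polynomial (A r F)) =
        (Polynomial.eval₂RingHom ((Polynomial.C : Polynomial (A r F) →+* _).comp Polynomial.C)
          (Polynomial.X + Polynomial.C Polynomial.X)).comp (θ : A r F →+* _) := by
      refine ringHom_ext_of_toA ?_ (fun c => by simp [hk]) (by simpa [ha] using toA_monoX_ne_zero)
      rintro (i | i)
      · simp [hx]
      · fin_cases i
        · simp [hz, ha]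
          ring
        · simp [ht]
    exact DFunLike.congr_fun this b
  · have h1 : toA r F (X (Sum.inr 0)) ∈ ExpMaps.invariants θ := htop ▸ Algebra.mem_top
    rw [ExpMaps.mem_invariants, hz, add_eq_left] at h1
    simp [toA_monoX_ne_zero] at h1

/-- If `DK(A) = B` and `r_j > 0`, then `F(X_j = 0)` does not lie in `k[X_1, …, X_m]`. -/
theorem setZero_notMem_range_ofX (hF : ∀ j : Fin m, ¬ X (Sum.inl j) ∣ F)
    (hDK : ExpMaps.derksenInvariant k (A r F) = B r F) {j : Fin m} (hr : r j ≠ 0) :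
    setZero j F ∉ (ofX (k := k) (m := m)).range := by
  rintro ⟨p, hp⟩
  change ofX p = _ at hp
  have := isDomain_A r hF
  obtain ⟨θ, hθ, hne, hθx⟩ := exists_isExponentialMap (r := r) hF
  obtain ⟨q, hq⟩ := X_inl_dvd_sub_setZero j F
  obtain ⟨c, hc⟩ := (dvd_pow_self (X (Sum.inl j)) hr).trans (X_inl_pow_dvd_monoX (k := k) r j)
  have hX : toA r F (X (Sum.inl j)) ≠ 0 := fun h =>
    X_ne_zero (R := k) (Sum.inl j) ((map_eq_zero_iff _ (toA_injective r F)).mp h)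
  -- With `a = X_j c` and `F = F(X_j = 0) + X_j q`, the element `cy - q` is `F(X_j = 0)/x_j`. If the
  -- numerator is in `E`, it is a quotient of invariants, hence invariant, hence in `B`, and `X_j`
  -- divides `F`.
  have hw : toA r F (X (Sum.inl j)) * (toA r F c * y r F - toA r F q) = toA r F (ofX p) := by
    rw [hp, ← sub_sub_self F (setZero j F), hq, map_sub, ← toA_monoX_mul_y, hc, map_mul, map_mul]
    ring
  have hinv : toA r F c * y r F - toA r F q ∈ ExpMaps.invariants θ := by
    rw [ExpMaps.mem_invariants]
    have h1 := congrArg θ hw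
    have h2 : (X (Sum.inl j) : PolyXZT k m) = ofX (X j) := by simp [ofX]
    rw [map_mul, hθx, h2, hθx, ← h2, ← hw, Polynomial.C_mul] at h1
    exact mul_left_cancel₀ (Polynomial.C_ne_zero.mpr hX) h1
  have hB : toA r F c * y r F - toA r F q ∈ B r F :=
    hDK ▸ Algebra.subset_adjoin ⟨θ, hθ, hne, hinv⟩
  obtain ⟨s, hs⟩ := (mem_B_iff r F).mp hB
  rw [← hs, ← map_mul] at hw
  refine hF j ⟨s + q, ?_⟩
  rw [mul_add, ← hq, toA_injective r F hw, hp]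
  ring

end ExponentialMap

end LinearHypersurface

namespace LinearHypersurface

open MvPolynomial

/-! ### Automorphisms of `A` and the induced automorphisms of `R`. -/

section Automorphisms

variable {k : Type*} [Field k] {m : ℕ} {r : Fin m → ℕ} {F : PolyXZT k m}

theorem toA_C (c : k) : toA r F (C c) = algebraMap k _ c := (toA r F).commutes c

theorem exists_algEquiv_of_restrictsToAut {φ : A r F →ₐ[k] A r F}
    (h : ExpMaps.RestrictsToAut φ (B r F)) :
    ∃ ψ : PolyXZT k m ≃ₐ[k] PolyXZT k m, ∀ p, φ (toA r F p) = toA r F (ψ p) := by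
  obtain ⟨e, he⟩ := h
  let ε : PolyXZT k m ≃ₐ[k] B r F :=
    (AlgEquiv.ofInjective (toA r F) (toA_injective r F)).trans
      (Subalgebra.equivOfEq _ _ (B_eq_range r F).symm)
  have hε (p : PolyXZT k m) : (ε p : A r F) = toA r F p := rfl
  refine ⟨(ε.trans e).trans ε.symm, fun p => ?_⟩
  rw [← hε, ← hε, ← he]
  simp

theorem restrictsToAut_B_of_derksenInvariant
    (hDK : ExpMaps.derksenInvariant k (A r F) = B r F) (φ : A r F ≃ₐ[k] A r F) :
    ExpMaps.RestrictsToAut (φ : A r F →ₐ[k] A r F) (B r F) := by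
  rw [← hDK]
  refine ExpMaps.restrictsToAut_of_forall_mem_iff (fun s _ hs => ?_)
    (fun s hs => ExpMaps.apply_mem_derksenInvariant φ hs)
    (fun s hs => ⟨φ.symm s, ExpMaps.apply_mem_derksenInvariant φ.symm hs, φ.apply_symm_apply s⟩)
  exact (map_eq_zero_iff φ φ.injective).mp hs

theorem restrictsToAut_E_of_perm {φ : A r F →ₐ[k] A r F}
    {ψ : PolyXZT k m ≃ₐ[k] PolyXZT k m} (hψ : ∀ p, φ (toA r F p) = toA r F (ψ p))
    {σ : Equiv.Perm (Fin m)} {c : Fin m → k}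
    (hσ : ∀ i, c i ≠ 0 ∧ ψ (X (Sum.inl i)) = C (c i) * X (Sum.inl (σ i))) :
    ExpMaps.RestrictsToAut φ (E r F) := by
  have hx (i : Fin m) : φ (x r F i) = c i • x r F (σ i) := by
    rw [x, hψ, (hσ i).2, map_mul, toA_C, Algebra.smul_def, x]
  have hEx (i : Fin m) : x r F i ∈ E r F := Algebra.subset_adjoin ⟨i, rfl⟩
  have hmap : (E r F).map φ = E r F := by
    refine le_antisymm ?_ (Algebra.adjoin_le ?_)
    · rw [E, AlgHom.map_adjoin]
      refine Algebra.adjoin_le ?_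
      rintro _ ⟨_, ⟨i, rfl⟩, rfl⟩
      exact hx i ▸ Subalgebra.smul_mem _ (hEx _) _
    · rintro _ ⟨i, rfl⟩
      refine ⟨(c (σ.symm i))⁻¹ • x r F (σ.symm i), Subalgebra.smul_mem _ (hEx _) _, ?_⟩
      change φ _ = _
      rw [map_smul, hx, σ.apply_symm_apply, smul_smul, inv_mul_cancel₀ (hσ _).1, one_smul]
  refine ExpMaps.restrictsToAut_of_forall_mem_iff (fun s hs h0 => ?_)
    (fun s hs => hmap ▸ Subalgebra.mem_map.mpr ⟨s, hs, rfl⟩)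
    (fun s hs => Subalgebra.mem_map.mp (hmap.symm ▸ hs))
  rw [E_eq_range] at hs
  obtain ⟨p, rfl⟩ := hs
  change φ (toA r F (ofX p)) = 0 at h0
  rw [hψ, map_eq_zero_iff _ (toA_injective r F), map_eq_zero_iff _ ψ.injective] at h0
  change toA r F (ofX p) = 0
  rw [h0, map_zero]

theorem condB_of_perm {φ : A r F →ₐ[k] A r F}
    {ψ : PolyXZT k m ≃ₐ[k] PolyXZT k m} (hψ : ∀ p, φ (toA r F p) = toA r F (ψ p))
    {σ : Equiv.Perm (Fin m)} {c : Fin m → k}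
    (hσ : ∀ i, c i ≠ 0 ∧ ψ (X (Sum.inl i)) = C (c i) * X (Sum.inl (σ i)))
    (hr : ∀ i, r i ≤ r (σ i)) : CondB r F φ := by
  refine fun i => ⟨σ i, c i, (hσ i).1, ?_, eq_of_le_comp_perm hr i⟩
  rw [x, hψ, (hσ i).2, map_mul, toA_C, Algebra.smul_def, x]

theorem associated_map_monoX {ψ : PolyXZT k m ≃ₐ[k] PolyXZT k m}
    {σ : Equiv.Perm (Fin m)} {c : Fin m → k}
    (hσ : ∀ i, c i ≠ 0 ∧ ψ (X (Sum.inl i)) = C (c i) * X (Sum.inl (σ i)))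
    (hr : ∀ i, r i = r (σ i)) : Associated (ψ (monoX k r)) (monoX k r) := by
  have h1 : monoX k r = ∏ i, (X (Sum.inl (σ i)) : PolyXZT k m) ^ r i := by
    rw [monoX, ← Equiv.prod_comp σ]
    exact Finset.prod_congr rfl fun i _ => by rw [← hr i]
  have h2 : ψ (monoX k r) = ∏ i, ψ (X (Sum.inl i)) ^ r i := by
    simp only [monoX, map_prod, map_pow]
  rw [h2, h1]
  refine Associated.prod _ _ _ fun i _ => ?_
  rw [(hσ i).2]
  exact Associated.pow_pow (associated_unit_mul_left _ _ ((hσ i).1.isUnit.map C))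

/-- An automorphism `φ` of `A` that restricts to `B` permutes the `x_i` up to scalars. -/
theorem exists_perm_of_algEquiv (hr : ∀ i, r i ≠ 0) (hF : ∀ j : Fin m, ¬ X (Sum.inl j) ∣ F)
    (φ : A r F ≃ₐ[k] A r F) {ψ : PolyXZT k m ≃ₐ[k] PolyXZT k m}
    (hψ : ∀ p, φ (toA r F p) = toA r F (ψ p)) :
    ∃ (σ : Equiv.Perm (Fin m)) (c : Fin m → k), ∀ i, c i ≠ 0 ∧
      ψ (X (Sum.inl i)) = C (c i) * X (Sum.inl (σ i)) := by
  obtain ⟨n, b, hb⟩ := exists_monoX_pow_mul_eq r F (φ (y r F))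
  -- This is `ψ(a)φ(y) = ψ(F)` multiplied by `a^n`.
  have h1 : ψ (monoX k r) * b = monoX k r ^ n * ψ F := by
    refine toA_injective r F ?_
    have := congrArg φ (toA_monoX_mul_y r F)
    rw [map_mul, hψ, hψ] at this
    rw [map_mul, map_mul, ← hb, ← this, map_pow]
    ring
  have h2 : IsRelPrime (ψ (monoX k r)) (ψ F) := by
    intro d hd hdF
    rw [← ψ.apply_symm_apply d, map_dvd_iff] at hd hdF
    have := (isRelPrime_monoX r hF hd hdF).map ψ
    rwa [ψ.apply_symm_apply] at this
  have h3 : ψ (monoX k r) ∣ monoX k r ^ n := h2.dvd_of_dvd_mul_right (Dvd.intro _ h1)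
  exact exists_perm_of_dvd ψ fun i => ⟨n, (map_dvd ψ
    ((dvd_pow_self _ (hr i)).trans (X_inl_pow_dvd_monoX r i))).trans h3⟩

/-- If `r_i > r_j`, then `x_i^{r_i} ∣ F` in `A` maps to `x_j^{r_i} ∣ ψ(F)`, so `ψ(F) ∈ (X_j, F)^2`.
Pulling back along `ψ` contradicts `not_mem_span_sq`. -/
theorem le_of_algEquiv (hr : ∀ i, 1 < r i) (hF0 : killX F ≠ 0)
    (hF : ∀ j, setZero j F ∉ (ofX (k := k) (m := m)).range)
    (φ : A r F ≃ₐ[k] A r F) {ψ : PolyXZT k m ≃ₐ[k] PolyXZT k m}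
    (hψ : ∀ p, φ (toA r F p) = toA r F (ψ p)) {i j : Fin m} {c : k} (hc : c ≠ 0)
    (hij : ψ (X (Sum.inl i)) = C c * X (Sum.inl j)) : r i ≤ r j := by
  by_contra! hlt
  have hX (l : Fin m) : (X (Sum.inl l) : PolyXZT k m) ∣ monoX k r :=
    (dvd_pow_self _ (by have := hr l; omega)).trans (X_inl_pow_dvd_monoX r l)
  have hass : Associated (ψ (X (Sum.inl i))) (X (Sum.inl j)) := by
    rw [hij]; exact associated_unit_mul_left _ _ (hc.isUnit.map C)
  have hφ {p q : PolyXZT k m} (h : toA r F p ∣ toA r F q) :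
      toA r F (ψ p) ∣ toA r F (ψ q) := by
    rw [← hψ, ← hψ]; exact map_dvd φ h
  have h1 : ψ F ∈ Ideal.span {X (Sum.inl j), F} ^ 2 := by
    refine mem_span_sq_of_toA_dvd r hF0 (hr j) hlt ?_
    have h2 : toA r F (X (Sum.inl i) ^ r i) ∣ toA r F F :=
      toA_dvd_of_mem_span r F (X_inl_pow_dvd_monoX r i) (Ideal.subset_span (by simp))
    refine Dvd.dvd.trans ?_ (hφ h2)
    rw [← map_pow]
    refine map_dvd _ ?_
    rw [map_pow]
    exact pow_dvd_pow_of_dvd hass.symm.dvd _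
  -- These ideals are `x_jA ∩ B` and `x_iA ∩ B`, and `φ` matches `x_i` with `x_j` up to a unit.
  have h3 : Ideal.span {X (Sum.inl j), F} ≤ (Ideal.span {X (Sum.inl i), F}).map ψ := by
    intro p hp
    have h4 : toA r F (ψ (X (Sum.inl i))) ∣ toA r F p :=
      (map_dvd _ hass.dvd).trans (toA_dvd_of_mem_span r F (hX j) hp)
    rw [← ψ.apply_symm_apply p, ← hψ, ← hψ, map_dvd_iff] at h4
    rw [← ψ.apply_symm_apply p]
    exact Ideal.mem_map_of_mem _ (mem_span_of_toA_dvd (hX i) h4)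
  have h5 := Ideal.pow_right_mono h3 2 h1
  rw [← Ideal.map_pow] at h5
  obtain ⟨q, hq, hqF⟩ := (Ideal.mem_map_iff_of_surjective ψ ψ.surjective).mp h5
  rw [ψ.injective hqF] at hq
  exact not_mem_span_sq (not_X_inl_dvd_of_killX_ne_zero hF0 i) (hF i) hq

/-- `I = aA ∩ B` depends only on `a` up to a unit. -/
theorem condC_of_associated (φ : A r F ≃ₐ[k] A r F) {ψ : PolyXZT k m ≃ₐ[k] PolyXZT k m}
    (hψ : ∀ p, φ (toA r F p) = toA r F (ψ p))
    (hass : Associated (ψ (monoX k r)) (monoX k r)) :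
    CondC r F (φ : A r F →ₐ[k] A r F) := by
  have key (p : PolyXZT k m) :
      ψ p ∈ Ideal.span {monoX k r, F} ↔ p ∈ Ideal.span {monoX k r, F} := by
    have h (q : PolyXZT k m) : q ∈ Ideal.span {monoX k r, F} ↔ toA r F (monoX k r) ∣ toA r F q :=
      ⟨toA_dvd_of_mem_span r F dvd_rfl, mem_span_of_toA_dvd dvd_rfl⟩
    rw [h, h, ← (hass.map (toA r F)).dvd_iff_dvd_left, ← hψ, ← hψ, map_dvd_iff]
  ext α
  constructor
  · rintro ⟨β, hβ, rfl⟩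
    obtain ⟨p, hp, rfl⟩ := (mem_ISet_iff r F).mp hβ
    exact (mem_ISet_iff r F).mpr ⟨ψ p, (key p).mpr hp, (hψ p).symm⟩
  · intro hα
    obtain ⟨p, hp, rfl⟩ := (mem_ISet_iff r F).mp hα
    refine ⟨toA r F (ψ.symm p), (mem_ISet_iff r F).mpr ⟨_, (key _).mp ?_, rfl⟩, ?_⟩
    · rwa [ψ.apply_symm_apply]
    · exact (hψ _).trans (by rw [ψ.apply_symm_apply])

/-- An endomorphism `φ` of `A` that restricts to automorphisms of `E` and `B` with `φ(I) = I`
preserves `x_1^{r_1} ⋯ x_m^{r_m}` up to a unit of `B`. -/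
theorem associated_map_monoX_of_condC
    (hF : ∀ j, setZero j F ∉ (ofX (k := k) (m := m)).range) {φ : A r F →ₐ[k] A r F}
    {ψ : PolyXZT k m ≃ₐ[k] PolyXZT k m} (hψ : ∀ p, φ (toA r F p) = toA r F (ψ p))
    (hE : ExpMaps.RestrictsToAut φ (E r F)) (hC : CondC r F φ) :
    Associated (ψ (monoX k r)) (monoX k r) := by
  have hmem : monoX k r ∈ Ideal.span {monoX k r, F} := Ideal.subset_span (by simp)
  have haE : toA r F (monoX k r) ∈ E r F := (toA_mem_E_iff r F).mpr (monoX_mem_range_ofX r)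
  have haI : toA r F (monoX k r) ∈ ISet r F := (mem_ISet_iff r F).mpr ⟨_, hmem, rfl⟩
  refine associated_of_dvd_dvd ?_ ?_
  -- `a` has a preimage in `E` and one in `I`. They coincide because `φ` is injective on `B`, so
  -- this preimage lies in `I ∩ E` and is a multiple of `a`.
  · obtain ⟨u, hu, hua⟩ := hE.exists_apply_eq haE
    obtain ⟨v, hv, hva⟩ : toA r F (monoX k r) ∈ φ '' ISet r F := hC.symm ▸ haI
    obtain ⟨p, hp, rfl⟩ := (mem_ISet_iff r F).mp hv
    rw [E_eq_range] at hu
    obtain ⟨q, rfl⟩ := hu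
    change φ (toA r F (ofX q)) = _ at hua
    rw [hψ] at hua hva
    have hpq : p = ofX q := ψ.injective (toA_injective r F (hva.trans hua.symm))
    have hpa : ψ p = monoX k r := toA_injective r F hva
    suffices h : ψ (monoX k r) ∣ ψ p from hpa ▸ h
    refine map_dvd ψ ?_
    exact monoX_dvd_of_mem_span hF (hpq ▸ ⟨q, rfl⟩) hp
  · have h1 : toA r F (ψ (monoX k r)) ∈ E r F := hψ (monoX k r) ▸ hE.apply_mem haE
    have h2 : toA r F (ψ (monoX k r)) ∈ ISet r F :=
      hψ (monoX k r) ▸ hC ▸ Set.mem_image_of_mem φ haI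
    obtain ⟨p, hp, hpa⟩ := (mem_ISet_iff r F).mp h2
    rw [toA_injective r F hpa] at hp
    exact monoX_dvd_of_mem_span hF ((toA_mem_E_iff r F).mp h1) hp

/-- Injectivity passes from `B` to `A` by clearing denominators. For surjectivity only `y` is at
stake. -/
theorem bijective_of_condC (hF : ∀ j : Fin m, ¬ X (Sum.inl j) ∣ F) {φ : A r F →ₐ[k] A r F}
    {ψ : PolyXZT k m ≃ₐ[k] PolyXZT k m} (hψ : ∀ p, φ (toA r F p) = toA r F (ψ p))
    (hass : Associated (ψ (monoX k r)) (monoX k r)) (hC : CondC r F φ) :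
    Function.Bijective φ := by
  have := isDomain_A r hF
  have ha : toA r F (monoX k r) ≠ 0 := toA_monoX_ne_zero
  refine ⟨(injective_iff_map_eq_zero _).mpr fun α hα => ?_, ?_⟩
  · obtain ⟨n, p, hp⟩ := exists_monoX_pow_mul_eq r F α
    have h1 := congrArg φ hp
    rw [map_mul, hα, mul_zero, hψ, eq_comm, map_eq_zero_iff _ (toA_injective r F),
      map_eq_zero_iff _ ψ.injective] at h1
    rw [h1, map_zero] at hp
    exact (mul_eq_zero.mp hp).resolve_left (pow_ne_zero _ ha)
  · have hB (p : PolyXZT k m) : toA r F p ∈ φ.range :=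
      ⟨toA r F (ψ.symm p), (hψ _).trans (by rw [ψ.apply_symm_apply])⟩
    have hy : y r F ∈ φ.range := by
      obtain ⟨u, hu⟩ := hass.symm
      have hFI : toA r F F ∈ φ '' ISet r F :=
        hC.symm ▸ (mem_ISet_iff r F).mpr ⟨F, Ideal.subset_span (by simp), rfl⟩
      obtain ⟨_, hβ, hβF⟩ := hFI
      obtain ⟨p, hp, rfl⟩ := (mem_ISet_iff r F).mp hβ
      obtain ⟨γ, hγ⟩ := toA_dvd_of_mem_span r F dvd_rfl hp
      -- `F = φ(p)` with `p = aγ` in `A`, so `ay = ψ(a)φ(γ)`, and `ψ(a) = au` allows cancelling `a`.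
      have h1 : y r F = toA r F u * φ γ := by
        refine mul_left_cancel₀ ha ?_
        rw [toA_monoX_mul_y, ← hβF, hγ, map_mul, hψ, ← hu, map_mul]
        ring
      rw [h1]
      exact mul_mem (hB _) ⟨γ, rfl⟩
    intro α
    obtain ⟨P, rfl⟩ := quotientMap_surjective r F α
    change _ ∈ φ.range
    induction P using Polynomial.induction_on' with
    | add P Q hP hQ => rw [map_add]; exact add_mem hP hQ
    | monomial n p =>
      rw [← Polynomial.C_mul_X_pow_eq_monomial, map_mul, map_pow]
      exact mul_mem (hB p) (pow_mem hy n)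

theorem le_of_associated_map_monoX {ψ : PolyXZT k m ≃ₐ[k] PolyXZT k m}
    (hass : Associated (ψ (monoX k r)) (monoX k r)) {i j : Fin m} {c : k}
    (hij : ψ (X (Sum.inl i)) = C c * X (Sum.inl j)) : r i ≤ r j := by
  refine le_of_X_inl_pow_dvd_monoX (k := k) ?_
  have h1 := (map_dvd ψ (X_inl_pow_dvd_monoX (k := k) r i)).trans hass.dvd
  rw [map_pow, hij] at h1
  exact (pow_dvd_pow_of_dvd (Dvd.intro_left _ rfl) _).trans h1

end Automorphisms

end LinearHypersurface

theorem mainTheorem5 {k : Type*} [Field k] {m : ℕ} (hm : 1 ≤ m)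
    (r : Fin m → ℕ) (hr : ∀ i, 1 < r i)
    (f : MvPolynomial (Fin 2) k) (hf : f ≠ 0)
    (h : LinearHypersurface.PolyXZT k m)
    (hh : h ∈ Ideal.span
      (Set.range fun i : Fin m => (MvPolynomial.X (Sum.inl i) : LinearHypersurface.PolyXZT k m)))
    (F : LinearHypersurface.PolyXZT k m) (hF : F = LinearHypersurface.ofZT m f + h)
    (hDK : ExpMaps.derksenInvariant k (LinearHypersurface.A r F) = LinearHypersurface.B r F) :
    (∀ φ : LinearHypersurface.A r F ≃ₐ[k] LinearHypersurface.A r F,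
      LinearHypersurface.CondA r F (φ : LinearHypersurface.A r F →ₐ[k] LinearHypersurface.A r F) ∧
      LinearHypersurface.CondB r F (φ : LinearHypersurface.A r F →ₐ[k] LinearHypersurface.A r F) ∧
      LinearHypersurface.CondC r F (φ : LinearHypersurface.A r F →ₐ[k] LinearHypersurface.A r F)) ∧
    (∀ φ : LinearHypersurface.A r F →ₐ[k] LinearHypersurface.A r F,
      LinearHypersurface.CondA r F φ → LinearHypersurface.CondC r F φ →
        LinearHypersurface.CondB r F φ ∧ Function.Bijective φ) := by
  open LinearHypersurface MvPolynomial in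
  -- Setting all `X_i = 0` leaves `f` from `F`.
  have hF0 : killX F ≠ 0 := by
    have h1 : Ideal.span (Set.range fun i : Fin m => (X (Sum.inl i) : PolyXZT k m)) ≤
        RingHom.ker (killX (k := k) (m := m)) := by
      refine Ideal.span_le.mpr ?_
      rintro _ ⟨i, rfl⟩
      exact killX_X_inl i
    rw [hF, map_add, killX_ofZT, (RingHom.mem_ker).mp (h1 hh), add_zero]
    exact fun h0 => hf (rename_injective _ Sum.inr_injective (h0.trans (map_zero _).symm))
  have hFX := LinearHypersurface.not_X_inl_dvd_of_killX_ne_zero hF0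
  have hFE (j : Fin m) := LinearHypersurface.setZero_notMem_range_ofX hFX hDK
    (Nat.ne_zero_of_lt (hr j))
  have hr0 (i : Fin m) : r i ≠ 0 := Nat.ne_zero_of_lt (hr i)
  refine ⟨fun φ => ?_, fun φ ⟨hE, hB⟩ hC => ?_⟩
  · have hB := LinearHypersurface.restrictsToAut_B_of_derksenInvariant hDK φ
    obtain ⟨ψ, hψ⟩ := LinearHypersurface.exists_algEquiv_of_restrictsToAut hB
    obtain ⟨σ, c, hσ⟩ := LinearHypersurface.exists_perm_of_algEquiv hr0 hFX φ hψ
    have hle (i : Fin m) : r i ≤ r (σ i) :=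
      LinearHypersurface.le_of_algEquiv hr hF0 hFE φ hψ (hσ i).1 (hσ i).2
    have hass := LinearHypersurface.associated_map_monoX hσ
      (LinearHypersurface.eq_of_le_comp_perm hle)
    exact ⟨⟨LinearHypersurface.restrictsToAut_E_of_perm hψ hσ, hB⟩,
      LinearHypersurface.condB_of_perm hψ hσ hle,
      LinearHypersurface.condC_of_associated φ hψ hass⟩
  · obtain ⟨ψ, hψ⟩ := LinearHypersurface.exists_algEquiv_of_restrictsToAut hB
    have hass := LinearHypersurface.associated_map_monoX_of_condC hFE hψ hE hC
    obtain ⟨σ, c, hσ⟩ := LinearHypersurface.exists_perm_of_dvd (r := r) ψ fun i =>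
      ⟨1, by
        rw [pow_one]
        exact (map_dvd ψ ((dvd_pow_self _ (hr0 i)).trans
          (LinearHypersurface.X_inl_pow_dvd_monoX r i))).trans hass.dvd⟩
    exact ⟨LinearHypersurface.condB_of_perm hψ hσ fun i =>
        LinearHypersurface.le_of_associated_map_monoX hass (hσ i).2,
      LinearHypersurface.bijective_of_condC hFX hψ hass hC⟩
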